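/- Let $G=(V,E)$ be a finite simple graph. A neighborhood system $\Sigma$ for $G$ assigns to every vertex $v\in V$ a subset $\Sigma(v)\subseteq N(v)$ of the set of neighbors of $v$ in $G$; it is non-empty if $\Sigma(v)\neq\emptyset$ for at least one $v$. A $\Sigma$-coloring is an assignment of colors to the vertices of $G$ such that any two distinct vertices that appear together in some $\Sigma(v)$ receive different colors (it need not be a proper coloring of $G$). Let $\chi(\Sigma)$ be the minimum number of colors in a $\Sigma$-coloring, and let $\rho(\Sigma)=\max_{v\in V}|\Sigma(v)|$. For a non-negative integer $t$, the graph $G$ is $K_t$-minor-free if the complete graph $K_t$ is not a minor of $G$, i.e. $G$ does not contain $t$ pairwise disjoint non-empty vertex sets, each inducing a connected subgraph, with an edge of $G$ between any two of them. There is an absolute constant $c$ such that for every $t$, every finite $K_t$-minor-free graph $G$ and every non-empty neighborhood system $\Sigma$ for $G$, $$\chi(\Sigma)\le c\,t^4(\log t)^2\,\rho(\Sigma).$$ -/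

import Mathlib

namespace SimpleGraph

/-- `H` is a minor of `G`: there are pairwise disjoint branch sets in `G`, one for each vertex of
`H`, each inducing a connected (in particular nonempty) subgraph of `G`, such that `G` has an edge
between the branch sets of any two adjacent vertices of `H`. -/
def IsMinor {W V : Type*} (H : SimpleGraph W) (G : SimpleGraph V) : Prop :=
  ∃ B : W → Set V,
    (∀ a, (G.induce (B a)).Connected) ∧
    (∀ a b, a ≠ b → Disjoint (B a) (B b)) ∧
    (∀ a b, H.Adj a b → ∃ x ∈ B a, ∃ y ∈ B b, G.Adj x y)

/-- `G` is `K_t`-minor-free: the complete graph on `t` vertices is not a minor of `G`. -/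
def CompleteMinorFree {V : Type*} (G : SimpleGraph V) (t : ℕ) : Prop :=
  ¬ IsMinor (completeGraph (Fin t)) G

end SimpleGraph

/-- A neighborhood system for `G`: for each vertex `v`, a set of neighbors of `v` in `G`. -/
structure NeighborhoodSystem {V : Type*} (G : SimpleGraph V) where
  /-- the chosen set of neighbors of each vertex -/
  nbhd : V → Finset V
  adj_of_mem : ∀ v, ∀ u ∈ nbhd v, G.Adj v u

namespace NeighborhoodSystem

/-- A `Σ`-coloring: any two distinct vertices appearing together in some `Σ(w)` receive
different colors. -/
def IsColoring {V α : Type*} {G : SimpleGraph V} (S : NeighborhoodSystem G) (f : V → α) : Prop :=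
  ∀ w, ∀ u ∈ S.nbhd w, ∀ v ∈ S.nbhd w, u ≠ v → f u ≠ f v

/-- `χ(Σ)`: the least number of colors for which a `Σ`-coloring exists. -/
noncomputable def chromaticNumber {V : Type*} {G : SimpleGraph V}
    (S : NeighborhoodSystem G) : ℕ :=
  sInf {k : ℕ | ∃ f : V → Fin k, S.IsColoring f}

/-- On a finite vertex set, `Σ`-colorings with finitely many colors exist, so the infimum in
`chromaticNumber` is a minimum over a nonempty set. -/
theorem exists_isColoring {V : Type*} [Finite V] {G : SimpleGraph V} (S : NeighborhoodSystem G) :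
    {k : ℕ | ∃ f : V → Fin k, S.IsColoring f}.Nonempty :=
  ⟨Nat.card V, Finite.equivFin V, fun _ _ _ _ _ huv h => huv ((Finite.equivFin V).injective h)⟩

/-- `ρ(Σ)`: the maximum of `|Σ(v)|` over all vertices `v`. -/
def rho {V : Type*} [Fintype V] {G : SimpleGraph V} (S : NeighborhoodSystem G) : ℕ :=
  Finset.univ.sup fun v => (S.nbhd v).card

/-- `Σ` is nonempty: some `Σ(v)` is a nonempty set. -/
def IsNonempty {V : Type*} {G : SimpleGraph V} (S : NeighborhoodSystem G) : Prop :=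
  ∃ v, (S.nbhd v).Nonempty

end NeighborhoodSystem

open Finset

/-! ### Minors by contracting stars -/

namespace SimpleGraph

/-! Join two vertices when they share some Σ(w). If every vertex set X spans O(d²ρ|X|) such pairs,
where d = O(t²) bounds the edge density of `K_t`-minor-free graphs, then greedy colouring uses
O(t⁴ρ) colours; the logarithms only add slack. To count the pairs (`card_pairs_le`), contract
vertices w outside X onto members of Σ(w) ∩ X as long as each contraction creates a new edge on X
(`exists_contraction`). The result is a minor of G, so it has O(d|X|) edges, and hence the absorbed
set W has size O(d|X|). Pairs seen from outside X ∪ W are edges of this minor. Pairs seen from w in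
X ∪ W number at most ρ·|Σ(w) ∩ X|, and the sum of |Σ(w) ∩ X| is bounded by the edge density of G on
X ∪ W. The density bound `isMinor_completeGraph_of_ncard_edgeSet` comes from contracting edges until
some neighbourhood is dense. -/

theorem IsMinor.refl {W : Type*} (H : SimpleGraph W) : IsMinor H H := by
  refine ⟨fun a => {a}, fun a => ?_, fun a b hab => by simpa using hab, fun a b h => ⟨a, rfl, b, rfl, h⟩⟩
  have : Subsingleton ({a} : Set W) := inferInstance
  have : Nonempty ({a} : Set W) := ⟨⟨a, rfl⟩⟩
  exact ⟨fun x y => by rw [Subsingleton.elim x y]⟩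

/-- Minors pass from `M` to `G` if `M` is obtained from a subgraph of `G` by contracting disjoint
stars `P x` with centres `c x`. -/
theorem IsMinor.of_stars {U W V : Type*} {H : SimpleGraph U} {M : SimpleGraph W}
    {G : SimpleGraph V} (c : W → V) (P : W → Set V) (hc : ∀ x, c x ∈ P x)
    (hP : ∀ x, ∀ w ∈ P x, w = c x ∨ G.Adj w (c x))
    (hd : ∀ x y, x ≠ y → Disjoint (P x) (P y))
    (hM : ∀ x y, M.Adj x y → ∃ a ∈ P x, ∃ b ∈ P y, G.Adj a b) (h : IsMinor H M) :
    IsMinor H G := by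
  obtain ⟨B, hB, hBd, hBa⟩ := h
  have mem : ∀ {a x w}, x ∈ B a → w ∈ P x → w ∈ ⋃ x ∈ B a, P x := fun hx hw =>
    Set.mem_biUnion hx hw
  refine ⟨fun a => ⋃ x ∈ B a, P x, fun a => ?_, fun a b hab => ?_, fun a b hab => ?_⟩
  · have key : ∀ (x : W) (hx : x ∈ B a) (w : V) (hw : w ∈ P x),
        (G.induce (⋃ x ∈ B a, P x)).Reachable ⟨w, mem hx hw⟩ ⟨c x, mem hx (hc x)⟩ := by
      intro x hx w hw
      rcases hP x w hw with h | h
      · subst h; exact Reachable.refl _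
      · exact Adj.reachable (by simpa using h)
    have key2 : ∀ (x y : B a), (M.induce (B a)).Walk x y →
        (G.induce (⋃ x ∈ B a, P x)).Reachable ⟨c x, mem x.2 (hc x)⟩ ⟨c y, mem y.2 (hc y)⟩ := by
      intro x y p
      induction p with
      | nil => exact Reachable.refl _
      | @cons x z y hxz _ ih =>
        refine Reachable.trans ?_ ih
        obtain ⟨u, hu, w, hw, huw⟩ := hM x z (by simpa using hxz)
        refine (key x x.2 u hu).symm.trans (Reachable.trans ?_ (key z z.2 w hw))
        exact Adj.reachable (by simpa using huw)
    obtain ⟨x₀⟩ := (hB a).nonempty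
    have : Nonempty (⋃ x ∈ B a, P x : Set V) := ⟨⟨c x₀, mem x₀.2 (hc _)⟩⟩
    refine ⟨?_⟩
    rintro ⟨w, hw⟩ ⟨w', hw'⟩
    obtain ⟨x, hx, hwx⟩ := Set.mem_iUnion₂.1 hw
    obtain ⟨x', hx', hwx'⟩ := Set.mem_iUnion₂.1 hw'
    obtain ⟨p⟩ := (hB a).preconnected ⟨x, hx⟩ ⟨x', hx'⟩
    exact (key x hx w hwx).trans ((key2 _ _ p).trans (key x' hx' w' hwx').symm)
  · simp only [Set.disjoint_iUnion_left, Set.disjoint_iUnion_right]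
    intro x hx y hy
    exact hd _ _ fun h => Set.disjoint_left.1 (hBd a b hab) (h ▸ hy) (h ▸ hx)
  · obtain ⟨x, hx, y, hy, hxy⟩ := hBa a b hab
    obtain ⟨u, hu, w, hw, huw⟩ := hM x y hxy
    exact ⟨u, mem hx hu, w, mem hy hw, huw⟩

theorem IsMinor.of_le {U V : Type*} {H : SimpleGraph U} {G G' : SimpleGraph V} (hle : G ≤ G')
    (h : IsMinor H G) : IsMinor H G' := by
  obtain ⟨B, hB, hBd, hBa⟩ := h
  refine ⟨B, fun a => (hB a).mono fun _ _ h => hle h, hBd, fun a b hab => ?_⟩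
  obtain ⟨x, hx, y, hy, hxy⟩ := hBa a b hab
  exact ⟨x, hx, y, hy, hle hxy⟩

/-- Vertices any two of which have many common neighbours are the centres of a clique minor. -/
theorem isMinor_completeGraph_of_codegree {V : Type*} [DecidableEq V] {G : SimpleGraph V} {t : ℕ}
    (k : Fin t → V) (hk : Function.Injective k) (C : Fin t → Fin t → Finset V)
    (hC : ∀ i j, ∀ w ∈ C i j, G.Adj w (k i) ∧ G.Adj w (k j))
    (hcard : ∀ i j, t ^ 2 + t ≤ #(C i j)) : IsMinor (completeGraph (Fin t)) G := by
  let T : Fin t × Fin t → Finset V := fun p => C p.1 p.2 \ univ.image k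
  have hT : ∀ p, t ^ 2 ≤ #(T p) := fun p => by
    have h1 := le_card_sdiff (univ.image k) (C p.1 p.2)
    have h2 : #(univ.image k) ≤ t := card_image_le.trans (by simp)
    have h3 := hcard p.1 p.2
    have : #(T p) = #(C p.1 p.2 \ univ.image k) := rfl
    omega
  -- Hall's condition is immediate: there are only t² pairs, and each has t² candidate connectors.
  obtain ⟨f, hf, hfT⟩ := (all_card_le_biUnion_card_iff_exists_injective T).1 (by
    intro s
    rcases s.eq_empty_or_nonempty with rfl | ⟨p, hp⟩
    · simp
    · calc #s ≤ t ^ 2 := (card_le_univ s).trans (by simp [sq])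
        _ ≤ #(T p) := hT p
        _ ≤ _ := card_le_card (subset_biUnion_of_mem T hp))
  have hfk : ∀ p i, f p ≠ k i := fun p i h => by
    have := (mem_sdiff.1 (hfT p)).2
    rw [h] at this
    exact this (mem_image_of_mem _ (mem_univ _))
  have hfC : ∀ p, f p ∈ C p.1 p.2 := fun p => (mem_sdiff.1 (hfT p)).1
  refine IsMinor.of_stars k (fun i => insert (k i) (Set.range fun j => f (i, j)))
    (fun i => Set.mem_insert _ _) ?_ ?_ ?_ (IsMinor.refl _)
  · rintro i w (rfl | ⟨j, rfl⟩)
    · exact Or.inl rfl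
    · exact Or.inr (hC i j _ (hfC (i, j))).1
  · intro i j hij
    rw [Set.disjoint_left]
    rintro w (rfl | ⟨a, rfl⟩) (h | ⟨b, h⟩)
    · exact hij (hk h)
    · exact hfk _ _ h
    · exact hfk _ _ h
    · exact hij (congrArg Prod.fst (hf h)).symm
  · intro i j _
    exact ⟨f (i, j), Or.inr ⟨j, rfl⟩, k j, Or.inl rfl, (hC i j _ (hfC (i, j))).2⟩

end SimpleGraph

/-- A reflexive symmetric relation without three pairwise unrelated elements on a set with at
least `t ^ 2` elements has a clique of size `t`. -/
theorem exists_clique_of_no_independent_triple {V : Type*} [DecidableEq V] (N : Finset V)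
    (A : V → V → Prop) (hrefl : ∀ x ∈ N, A x x) (hsymm : ∀ x y, A x y → A y x)
    (h3 : ∀ x ∈ N, ∀ y ∈ N, ∀ z ∈ N, A x y ∨ A y z ∨ A x z) (t : ℕ) (hN : t ^ 2 ≤ #N) :
    ∃ K ⊆ N, #K = t ∧ ∀ x ∈ K, ∀ y ∈ K, A x y := by
  classical
  -- The non-neighbours of any x form a clique. If all such sets are smaller than t, choose
  -- greedily: each chosen vertex excludes at most t, itself included.
  by_cases hx : ∃ x ∈ N, t ≤ #{y ∈ N | ¬ A x y}
  · obtain ⟨x, hxN, hx⟩ := hx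
    obtain ⟨K, hK, hKc⟩ := exists_subset_card_eq hx
    refine ⟨K, hK.trans (filter_subset _ _), hKc, fun y hy z hz => ?_⟩
    have h1 := mem_filter.1 (hK hy)
    have h2 := mem_filter.1 (hK hz)
    rcases h3 x hxN y h1.1 z h2.1 with h | h | h
    · exact absurd h h1.2
    · exact h
    · exact absurd h h2.2
  · push Not at hx
    suffices ∀ k ≤ t, ∃ K ⊆ N, #K = k ∧ ∀ x ∈ K, ∀ y ∈ K, A x y from this t le_rfl
    intro k
    induction k with
    | zero => exact fun _ => ⟨∅, by simp⟩
    | succ k ih =>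
      intro hk
      obtain ⟨K, hKN, hKc, hK⟩ := ih (by omega)
      have hbad : #(K.biUnion fun x => insert x {y ∈ N | ¬ A x y}) ≤ k * t := by
        rw [← hKc]
        refine card_biUnion_le_card_mul _ _ _ fun x hxK => ?_
        exact (card_insert_le _ _).trans (hx x (hKN hxK))
      obtain ⟨y, hyN, hy⟩ : ∃ y ∈ N, y ∉ K.biUnion fun x => insert x {y ∈ N | ¬ A x y} := by
        by_contra! hcon
        have := card_le_card hcon
        nlinarith
      simp only [mem_biUnion, mem_insert, mem_filter, not_exists, not_and, not_or, not_not] at hy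
      have hyA : ∀ x ∈ K, A x y := fun x hx => (hy x hx).2 hyN
      have hyK : y ∉ K := fun h => (hy y h).1 rfl
      refine ⟨insert y K, insert_subset hyN hKN, by rw [card_insert_of_notMem hyK, hKc], ?_⟩
      intro a ha b hb
      rcases mem_insert.1 ha with ha' | ha' <;> rcases mem_insert.1 hb with hb' | hb'
      · rw [ha', hb']; exact hrefl _ hyN
      · rw [ha']; exact hsymm _ _ (hyA _ hb')
      · rw [hb']; exact hyA _ ha'
      · exact hK _ ha' _ hb'

namespace SimpleGraph

/-- Three sets of size at least d inside 2d points cannot all have pairwise intersections below t² +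
t, by inclusion-exclusion. So large codegree is a relation without independent triples, and its
t-clique supplies the centres. -/
theorem isMinor_completeGraph_of_dense {V : Type*} [DecidableEq V] {G : SimpleGraph V} (t d : ℕ)
    (hd : 3 * (t ^ 2 + t) ≤ d) (N : Finset V) (hN : N.Nonempty) (hN2 : #N ≤ 2 * d)
    (C : V → Finset V) (hC : ∀ u ∈ N, C u ⊆ N) (hadj : ∀ u ∈ N, ∀ w ∈ C u, G.Adj w u)
    (hCd : ∀ u ∈ N, d ≤ #(C u)) : IsMinor (completeGraph (Fin t)) G := by
  obtain ⟨x₀, hx₀⟩ := hN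
  have hdN : d ≤ #N := (hCd _ hx₀).trans (card_le_card (hC _ hx₀))
  obtain ⟨K, hKN, hKc, hK⟩ := exists_clique_of_no_independent_triple N
    (fun x y => t ^ 2 + t ≤ #(C x ∩ C y)) (fun x hx => by
      have := hCd x hx
      simp only [inter_self]
      omega) (fun x y h => by rwa [inter_comm]) (by
      intro x hx y hy z hz
      by_contra! hcon
      obtain ⟨h1, h2, h3⟩ := hcon
      have hx' := hCd x hx
      have hy' := hCd y hy
      have hz' := hCd z hz
      have e1 := card_union_add_card_inter (C x) (C y)
      have e2 := card_union_add_card_inter (C x ∪ C y) (C z)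
      have e3 : #((C x ∪ C y) ∩ C z) ≤ #(C x ∩ C z) + #(C y ∩ C z) := by
        rw [union_inter_distrib_right]; exact card_union_le _ _
      have e4 : #(C x ∪ C y ∪ C z) ≤ #N :=
        card_le_card (union_subset (union_subset (hC x hx) (hC y hy)) (hC z hz))
      omega) t (by omega)
  let e := (K.equivFinOfCardEq hKc).symm
  refine isMinor_completeGraph_of_codegree (fun i => (e i : V))
    (Subtype.val_injective.comp e.injective) (fun i j => C (e i) ∩ C (e j)) ?_ ?_
  · intro i j w hw
    rw [mem_inter] at hw
    exact ⟨hadj _ (hKN (e i).2) _ hw.1, hadj _ (hKN (e j).2) _ hw.2⟩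
  · exact fun i j => hK _ (e i).2 _ (e j).2

end SimpleGraph

/-! ### Edge density of graphs without a clique minor -/

namespace SimpleGraph

open Classical in
theorem card_adj_pairs {V : Type*} [Fintype V] (G : SimpleGraph V) :
    #{p : V × V | G.Adj p.1 p.2} = 2 * G.edgeSet.ncard := by
  rw [← coe_edgeFinset, Set.ncard_coe_finset, ← sum_degrees_eq_twice_card_edges, ← univ_product_univ, card_filter, sum_product]
  refine sum_congr rfl fun v _ => ?_
  rw [← card_filter, ← card_neighborFinset_eq_degree]
  congr 1
  ext w
  simp

open Classical in
/-- Contracting an edge with `c` common neighbours at its ends loses at most `c + 1` edges. -/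
theorem card_adj_pairs_le_contract {V : Type*} [Fintype V] (G G' : SimpleGraph V) (u v : V)
    (huv : u ≠ v)
    (hG' : ∀ x y, G.Adj x y → (if x = v then u else x) ≠ (if y = v then u else y) →
      G'.Adj (if x = v then u else x) (if y = v then u else y)) :
    #{p : V × V | G.Adj p.1 p.2} ≤
      #{p : V × V | G'.Adj p.1 p.2 ∧ p.1 ≠ v ∧ p.2 ≠ v} + (2 * #{y | G.Adj u y ∧ G.Adj v y} + 2) := by
  set c : Finset V := {y | G.Adj u y ∧ G.Adj v y} with hc
  -- Off these pairs the contraction map on ordered pairs is injective.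
  let bad : Finset (V × V) := (c.image fun y => (v, y)) ∪ (c.image fun y => (y, v)) ∪ {(u, v), (v, u)}
  have hbad : #bad ≤ 2 * #c + 2 := by
    refine (card_union_le _ _).trans (add_le_add ((card_union_le _ _).trans ?_) card_le_two)
    have h1 := card_image_le (s := c) (f := fun y => (v, y))
    have h2 := card_image_le (s := c) (f := fun y => (y, v))
    omega
  have hgood : #(({p : V × V | G.Adj p.1 p.2} : Finset (V × V)) \ bad) ≤
      #{p : V × V | G'.Adj p.1 p.2 ∧ p.1 ≠ v ∧ p.2 ≠ v} := by
    refine card_le_card_of_injOn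
      (fun p => (if p.1 = v then u else p.1, if p.2 = v then u else p.2)) ?_ ?_
    · rintro ⟨x, y⟩ hp
      simp only [bad, hc, coe_sdiff, Set.mem_sdiff, mem_coe, mem_filter, mem_univ, true_and, mem_union,
        mem_image, Prod.mk.injEq, mem_insert, mem_singleton, not_or, not_exists, not_and] at hp ⊢
      obtain ⟨hxy, h⟩ := hp
      have hne := hxy.ne
      refine ⟨hG' x y hxy ?_, ?_, ?_⟩ <;> grind
    · rintro ⟨x, y⟩ hp ⟨x', y'⟩ hp' heq
      simp only [bad, hc, coe_sdiff, Set.mem_sdiff, mem_coe, mem_filter, mem_univ, true_and, mem_union,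
        mem_image, Prod.mk.injEq, mem_insert, mem_singleton, not_or, not_exists, not_and] at hp hp' heq ⊢
      obtain ⟨hxy, h⟩ := hp
      obtain ⟨hxy', h'⟩ := hp'
      have s1 := hxy.symm
      have s2 := hxy'.symm
      have hne := hxy.ne
      have hne' := hxy'.ne
      grind
  have := le_card_sdiff bad ({p : V × V | G.Adj p.1 p.2} : Finset (V × V))
  omega

end SimpleGraph

namespace SimpleGraph

open Classical in
theorem card_adj_pairs_induce_compl {V : Type*} [Fintype V] (G : SimpleGraph V) (v : V) :
    #{p : V × V | G.Adj p.1 p.2 ∧ p.1 ≠ v ∧ p.2 ≠ v} ≤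
      2 * (G.induce {x | x ≠ v}).edgeSet.ncard := by
  rw [← card_adj_pairs]
  refine le_trans (card_le_card ?_) (card_image_le (f := Prod.map Subtype.val Subtype.val))
  rintro ⟨x, y⟩ h
  simp only [mem_filter, mem_univ, true_and] at h
  exact mem_image.2 ⟨(⟨x, h.2.1⟩, ⟨y, h.2.2⟩), by simpa using h.1, rfl⟩

/-- The graph obtained from `G` by contracting `v` onto `u`. -/
def contractOnto {V : Type*} [DecidableEq V] (G : SimpleGraph V) (u v : V) : SimpleGraph V where
  Adj a b := a ≠ b ∧ ∃ x y, G.Adj x y ∧ (if x = v then u else x) = a ∧ (if y = v then u else y) = b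
  symm := ⟨fun _ _ ⟨h, x, y, hxy, hx, hy⟩ => ⟨h.symm, y, x, hxy.symm, hy, hx⟩⟩
  loopless := ⟨fun _ h => h.1 rfl⟩

theorem IsMinor.of_contractOnto {U V : Type*} [DecidableEq V] {H : SimpleGraph U}
    {G : SimpleGraph V} {u v : V} (huv : G.Adj u v)
    (h : IsMinor H ((G.contractOnto u v).induce {x | x ≠ v})) : IsMinor H G := by
  refine IsMinor.of_stars (fun x => x.1) (fun x => {w | (if w = v then u else w) = x.1})
    (fun x => if_neg x.2) ?_ ?_ ?_ h
  · rintro ⟨x, hx⟩ w rfl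
    by_cases hw : w = v
    · right; simpa [hw] using huv.symm
    · left; simp [hw]
  · intro x y hxy
    rw [Set.disjoint_left]
    intro w hw hw'
    exact hxy (Subtype.ext (hw.symm.trans hw'))
  · rintro x y ⟨_, a, b, hab, ha, hb⟩
    exact ⟨a, ha, b, hb, hab⟩

theorem IsMinor.of_induce {U V : Type*} {H : SimpleGraph U} {G : SimpleGraph V} {s : Set V}
    (h : IsMinor H (G.induce s)) : IsMinor H G :=
  IsMinor.of_stars (fun x : s => x.1) (fun x => {x.1}) (fun _ => rfl) (fun _ _ h => Or.inl h)
    (fun x y hxy => by simpa [Subtype.ext_iff] using hxy)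
    (fun x y hxy => ⟨x, rfl, y, rfl, by simpa using hxy⟩) h

open Classical in
/-- A graph with average degree of order `t ^ 2` has a `K_t` minor. -/
theorem isMinor_completeGraph_of_ncard_edgeSet (t d : ℕ) (hd : 3 * (t ^ 2 + t) ≤ d)
    (hd1 : 1 ≤ d) (n : ℕ) : ∀ (V : Type*) [Fintype V] (G : SimpleGraph V), Nat.card V = n →
      0 < n → d * n ≤ G.edgeSet.ncard → IsMinor (completeGraph (Fin t)) G := by
  induction n with
  | zero => intro V _ G _ h; omega
  | succ n ih =>
    intro V _ G₀ hV _ hG₀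
    -- Trimming to exactly d(n + 1) edges makes the average degree 2d, so some vertex has degree at
    -- most 2d.
    obtain ⟨E, hE, hEc⟩ := Set.exists_subset_card_eq hG₀
    obtain ⟨G, hGle, hG⟩ : ∃ G ≤ G₀, G.edgeSet.ncard = d * (n + 1) := by
      refine ⟨fromEdgeSet E, ?_, ?_⟩
      · rw [← G₀.fromEdgeSet_edgeSet]
        exact fromEdgeSet_mono hE
      · rw [← hEc]
        congr 1
        ext e
        simp only [edgeSet_fromEdgeSet, Set.mem_sdiff]
        exact ⟨fun h => h.1, fun h => ⟨h, G₀.not_isDiag_of_mem_edgeSet (hE h)⟩⟩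
    refine IsMinor.of_le hGle ?_
    have hn : ∀ v : V, Nat.card {x | x ≠ v} = n := fun v => by
      have h1 := Set.ncard_add_ncard_compl {v}
      rw [Set.ncard_singleton, hV] at h1
      have h2 : ({x | x ≠ v} : Set V) = {v}ᶜ := rfl
      rw [h2, Nat.card_coe_set_eq]
      omega
    have hpairs := card_adj_pairs G
    have hsum : ∑ v, G.degree v = 2 * G.edgeSet.ncard := by
      rw [sum_degrees_eq_twice_card_edges, ← coe_edgeFinset, Set.ncard_coe_finset]
    have hn0 : 0 < n := by
      rcases Nat.eq_zero_or_pos n with rfl | h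
      · have hsub : Subsingleton V := (Nat.card_eq_one_iff_unique.1 hV).1
        have h0 : ∑ v, G.degree v = 0 := sum_eq_zero fun v _ => by
          rw [← card_neighborFinset_eq_degree, card_eq_zero, eq_empty_iff_forall_notMem]
          exact fun w hw => ((G.mem_neighborFinset v w).1 hw).ne (Subsingleton.elim _ _)
        nlinarith
      · exact h
    obtain ⟨v, hv⟩ : ∃ v, G.degree v ≤ 2 * d := by
      by_contra! hcon
      have := card_nsmul_le_sum univ (fun v => G.degree v) (2 * d + 1) fun v _ => hcon v
      rw [card_univ, ← Nat.card_eq_fintype_card, hV, smul_eq_mul] at this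
      nlinarith
    rw [mul_add] at hG
    by_cases h0 : G.degree v = 0
    · refine IsMinor.of_induce (ih {x | x ≠ v} (G.induce {x | x ≠ v}) (hn v) hn0 ?_)
      have h1 := card_adj_pairs_induce_compl G v
      have h2 : ∀ w, ¬ G.Adj v w := fun w hw => by
        have := (G.degree_pos_iff_exists_adj v).2 ⟨w, hw⟩
        omega
      have h3 : ({p : V × V | G.Adj p.1 p.2} : Finset (V × V)) ⊆
          ({p : V × V | G.Adj p.1 p.2 ∧ p.1 ≠ v ∧ p.2 ≠ v} : Finset (V × V)) := by
        rintro ⟨x, y⟩ h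
        simp only [mem_filter, mem_univ, true_and] at h ⊢
        exact ⟨h, fun hx => h2 y (hx ▸ h), fun hy => h2 x (hy ▸ h.symm)⟩
      have h4 := card_le_card h3
      omega
    -- Contracting such an edge loses at most d edges, which suits the induction. Otherwise the
    -- neighbourhood of v has at most 2d vertices and minimum degree at least d.
    · by_cases hc : ∃ u, G.Adj u v ∧ #{y | G.Adj u y ∧ G.Adj v y} < d
      · obtain ⟨u, huv, hc⟩ := hc
        have h1 := card_adj_pairs_le_contract G (G.contractOnto u v) u v huv.ne
          fun x y hxy hne => ⟨hne, x, y, hxy, rfl, rfl⟩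
        have h2 := card_adj_pairs_induce_compl (G.contractOnto u v) v
        refine IsMinor.of_contractOnto huv (ih _ _ (hn v) hn0 ?_)
        omega
      · push Not at hc
        refine isMinor_completeGraph_of_dense t d hd (G.neighborFinset v) ?_ (by simpa using hv)
          (fun u => {y | G.Adj u y ∧ G.Adj v y}) ?_ ?_ ?_
        · rw [← card_pos, card_neighborFinset_eq_degree]; omega
        · intro u _ y hy
          simpa using (mem_filter.1 hy).2.2
        · intro u _ y hy
          exact (mem_filter.1 hy).2.1.symm
        · exact fun u hu => hc u ((G.mem_neighborFinset v u).1 hu).symm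

end SimpleGraph

/-! ### Greedy colouring -/

open Classical in
/-- Greedy colouring of a degenerate symmetric relation. -/
theorem exists_coloring_of_degenerate {V : Type*} [Fintype V] (R : V → V → Prop)
    (hR : ∀ x y, R x y → R y x) (D : ℕ) (hD : 0 < D)
    (h : ∀ X : Finset V, X.Nonempty → ∃ v ∈ X, #{u ∈ X | R v u} < D) :
    ∃ f : V → Fin D, ∀ x y, x ≠ y → R x y → f x ≠ f y := by
  suffices ∀ n, ∀ X : Finset V, #X = n →
      ∃ f : V → Fin D, ∀ x ∈ X, ∀ y ∈ X, x ≠ y → R x y → f x ≠ f y by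
    obtain ⟨f, hf⟩ := this _ univ rfl
    exact ⟨f, fun x y => hf x (mem_univ _) y (mem_univ _)⟩
  intro n
  induction n with
  | zero =>
    intro X hX
    rw [card_eq_zero] at hX
    exact ⟨fun _ => ⟨0, hD⟩, by simp [hX]⟩
  | succ n ih =>
    intro X hX
    obtain ⟨v, hvX, hv⟩ := h X (card_pos.1 (by omega))
    obtain ⟨f, hf⟩ := ih (X.erase v) (by rw [card_erase_of_mem hvX]; omega)
    obtain ⟨c, hc⟩ : ∃ c, c ∉ ({u ∈ X | R v u} : Finset V).image f := by
      by_contra! hcon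
      have h1 := card_le_card (fun c _ => hcon c : (univ : Finset (Fin D)) ⊆ _)
      have h2 := card_image_le (s := ({u ∈ X | R v u} : Finset V)) (f := f)
      rw [card_univ, Fintype.card_fin] at h1
      omega
    have hc' : ∀ u ∈ X, R v u → f u ≠ c := fun u hu hvu huc =>
      hc (mem_image.2 ⟨u, mem_filter.2 ⟨hu, hvu⟩, huc⟩)
    refine ⟨Function.update f v c, fun x hx y hy hxy hRxy => ?_⟩
    by_cases hxv : x = v
    · subst hxv
      rw [Function.update_self, Function.update_of_ne hxy.symm]
      exact (hc' y hy hRxy).symm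
    · rw [Function.update_of_ne hxv]
      by_cases hyv : y = v
      · subst hyv
        rw [Function.update_self]
        exact hc' x hx (hR _ _ hRxy)
      · rw [Function.update_of_ne hyv]
        exact hf x (mem_erase.2 ⟨hxv, hx⟩) y (mem_erase.2 ⟨hyv, hy⟩) hxy hRxy

/-! ### Edge counts on vertex subsets and their contractions -/

namespace SimpleGraph

open Classical in
theorem CompleteMinorFree.card_adj_pairs_le {V : Type*} [Fintype V] {G : SimpleGraph V} {t d : ℕ}
    (hG : G.CompleteMinorFree t) (hd : 3 * (t ^ 2 + t) ≤ d) (hd1 : 1 ≤ d) (X : Finset V) :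
    #{p ∈ X ×ˢ X | G.Adj p.1 p.2} ≤ 2 * (d * #X) := by
  rcases X.eq_empty_or_nonempty with rfl | hX
  · simp
  have h1 : (G.induce (X : Set V)).edgeSet.ncard < d * #X := by
    by_contra! hcon
    exact hG (IsMinor.of_induce (isMinor_completeGraph_of_ncard_edgeSet t d hd hd1 #X (X : Set V)
      (G.induce (X : Set V)) (by simp) (card_pos.2 hX) hcon))
  have h2 : #{p ∈ X ×ˢ X | G.Adj p.1 p.2} ≤ 2 * (G.induce (X : Set V)).edgeSet.ncard := by
    rw [← card_adj_pairs]
    refine le_trans (card_le_card ?_) (card_image_le (f := Prod.map Subtype.val Subtype.val))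
    rintro ⟨x, y⟩ h
    simp only [mem_filter, mem_product] at h
    exact mem_image.2 ⟨(⟨x, h.1.1⟩, ⟨y, h.1.2⟩), by simpa using h.2, rfl⟩
  omega

/-- The graph on `X` obtained from `G` by contracting each fibre of `φ` over `X` to a point. -/
def contractFibers {V : Type*} (G : SimpleGraph V) (X : Finset V) (φ : V → V) :
    SimpleGraph V where
  Adj a b := a ≠ b ∧ a ∈ X ∧ b ∈ X ∧ ∃ x y, G.Adj x y ∧ φ x = a ∧ φ y = b
  symm := ⟨fun _ _ ⟨h, ha, hb, x, y, hxy, hx, hy⟩ => ⟨h.symm, hb, ha, y, x, hxy.symm, hy, hx⟩⟩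
  loopless := ⟨fun _ h => h.1 rfl⟩

open Classical in
theorem CompleteMinorFree.card_contractFibers_pairs_le {V : Type*} [Fintype V] {G : SimpleGraph V}
    {t d : ℕ} (hG : G.CompleteMinorFree t) (hd : 3 * (t ^ 2 + t) ≤ d) (hd1 : 1 ≤ d) (X : Finset V)
    (φ : V → V) (hφX : ∀ x ∈ X, φ x = x) (hφ : ∀ w ∉ X, φ w ∈ X → G.Adj w (φ w)) :
    #{p ∈ X ×ˢ X | (G.contractFibers X φ).Adj p.1 p.2} ≤ 2 * (d * #X) := by
  have hM : ((G.contractFibers X φ).induce (X : Set V)).CompleteMinorFree t := by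
    refine fun h => hG (IsMinor.of_stars (fun x => x.1) (fun x => {w | φ w = x.1})
      (fun x => hφX _ x.2) ?_ ?_ ?_ h)
    · rintro ⟨x, hx⟩ w rfl
      by_cases hw : w ∈ X
      · exact Or.inl (hφX w hw).symm
      · exact Or.inr (hφ w hw hx)
    · intro x y hxy
      rw [Set.disjoint_left]
      intro w hw hw'
      exact hxy (Subtype.ext (hw.symm.trans hw'))
    · rintro x y ⟨_, _, _, a, b, hab, ha, hb⟩
      exact ⟨a, ha, b, hb, hab⟩
  have h1 := hM.card_adj_pairs_le hd hd1 univ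
  rw [card_univ, ← Nat.card_eq_fintype_card, Nat.card_coe_set_eq, Set.ncard_coe_finset] at h1
  refine le_trans (le_trans (card_le_card ?_)
    (card_image_le (f := Prod.map Subtype.val Subtype.val))) h1
  rintro ⟨x, y⟩ h
  simp only [mem_filter, mem_product] at h
  exact mem_image.2 ⟨(⟨x, h.1.1⟩, ⟨y, h.1.2⟩), by simpa using h.2, rfl⟩

end SimpleGraph

/-! ### Counting conflicting pairs -/

namespace NeighborhoodSystem

open Classical SimpleGraph in
/-- All pairs in `X` seen by a vertex outside `X` are adjacent in a contraction of `G` onto `X`,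
apart from those seen by the vertices of a set `W` that is not much larger than `X`. -/
theorem exists_contraction {V : Type*} [Fintype V] {G : SimpleGraph V} (S : NeighborhoodSystem G)
    (X : Finset V) : ∃ φ : V → V, ∃ W : Finset V, (∀ x ∈ X, φ x = x) ∧
      (∀ w ∉ X, φ w ∈ X → G.Adj w (φ w)) ∧
      #W ≤ #{p ∈ X ×ˢ X | (G.contractFibers X φ).Adj p.1 p.2} ∧
      ∀ w ∉ X, w ∉ W → ∀ u ∈ S.nbhd w, ∀ u' ∈ S.nbhd w, u ∈ X → u' ∈ X → u ≠ u' →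
        (G.contractFibers X φ).Adj u u' := by
  let W : (V → V) → Finset V := fun φ => {w | w ∉ X ∧ φ w ∈ X}
  let A : Finset (V → V) := {φ | (∀ x ∈ X, φ x = x) ∧ (∀ w ∉ X, φ w ∈ X → G.Adj w (φ w)) ∧
    #(W φ) ≤ #{p ∈ X ×ˢ X | (G.contractFibers X φ).Adj p.1 p.2}}
  have hA : A.Nonempty := by
    refine ⟨id, mem_filter.2 ⟨mem_univ _, fun _ _ => rfl, fun w hw hw' => absurd hw' hw, ?_⟩⟩
    have : W id = ∅ := by simp [W]
    rw [this, card_empty]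
    exact Nat.zero_le _
  obtain ⟨φ, hφA, hmax⟩ := exists_max_image A (fun φ => #(W φ)) hA
  obtain ⟨h1, h2, h3⟩ := (mem_filter.1 hφA).2
  -- If u and u' were not adjacent, sending w to u would add the edge uu' and enlarge W by one,
  -- contradicting maximality. Old edges survive because w lay in no fibre over X.
  refine ⟨φ, W φ, h1, h2, h3, fun w hw hwW u hu u' hu' huX huX' hne => ?_⟩
  have hφw : φ w ∉ X := fun h => hwW (mem_filter.2 ⟨mem_univ _, hw, h⟩)
  by_contra hnadj
  have hXw : ∀ x ∈ X, x ≠ w := fun x hx h => hw (h ▸ hx)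
  have hW : W (Function.update φ w u) = insert w (W φ) := by
    ext z
    by_cases hz : z = w
    · subst hz; simp [W, hw, huX]
    · simp [W, hz]
  have hWc : #(W (Function.update φ w u)) = #(W φ) + 1 := by rw [hW, card_insert_of_notMem hwW]
  have hmem : Function.update φ w u ∈ A := by
    refine mem_filter.2 ⟨mem_univ _, fun x hx => ?_, fun z hz hzX => ?_, ?_⟩
    · rw [Function.update_of_ne (hXw x hx), h1 x hx]
    · by_cases hzw : z = w
      · subst hzw
        simpa using S.adj_of_mem z u hu
      · rw [Function.update_of_ne hzw] at hzX ⊢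
        exact h2 z hz hzX
    · rw [hWc]
      refine (Nat.succ_le_succ h3).trans (Nat.succ_le_of_lt (card_lt_card ?_))
      rw [ssubset_iff_of_subset]
      · refine ⟨(u, u'), ?_, fun h => hnadj (mem_filter.1 h).2⟩
        refine mem_filter.2 ⟨mem_product.2 ⟨huX, huX'⟩, hne, huX, huX', w, u',
          S.adj_of_mem w u' hu', Function.update_self .., ?_⟩
        rw [Function.update_of_ne (hXw u' huX'), h1 u' huX']
      · rintro ⟨a, b⟩ hab
        obtain ⟨hab1, hab2, ha, hb, x, y, hxy, hx, hy⟩ := mem_filter.1 hab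
        have hup : ∀ z, φ z ∈ X → Function.update φ w u z = φ z := fun z hz =>
          Function.update_of_ne (fun h : z = w => hφw (h ▸ hz)) _ _
        exact mem_filter.2 ⟨hab1, hab2, ha, hb, x, y, hxy, (hup x (hx ▸ ha)).trans hx,
          (hup y (hy ▸ hb)).trans hy⟩
  have := hmax _ hmem
  omega

open Classical SimpleGraph in
theorem card_pairs_le {V : Type*} [Fintype V] {G : SimpleGraph V} {t d : ℕ}
    (hG : G.CompleteMinorFree t) (hd : 3 * (t ^ 2 + t) ≤ d) (hd1 : 1 ≤ d)
    (S : NeighborhoodSystem G) (hρ : 1 ≤ S.rho) (X : Finset V) :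
    #{p ∈ X ×ˢ X | p.1 ≠ p.2 ∧ ∃ w, p.1 ∈ S.nbhd w ∧ p.2 ∈ S.nbhd w} ≤
      8 * d ^ 2 * S.rho * #X := by
  obtain ⟨φ, W, h1, h2, h3, h4⟩ := S.exists_contraction X
  have hM := hG.card_contractFibers_pairs_le hd hd1 X φ h1 h2
  have hY := hG.card_adj_pairs_le hd hd1 (X ∪ W)
  have hYc := card_union_le X W
  have hsum : ∑ w ∈ X ∪ W, #(S.nbhd w ∩ X) ≤ #{p ∈ (X ∪ W) ×ˢ (X ∪ W) | G.Adj p.1 p.2} := by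
    rw [card_filter, sum_product]
    refine sum_le_sum fun w _ => ?_
    rw [← card_filter]
    refine card_le_card fun u hu => ?_
    rw [mem_inter] at hu
    exact mem_filter.2 ⟨mem_union_left _ hu.2, S.adj_of_mem w u hu.1⟩
  have hsq : ∑ w ∈ X ∪ W, #((S.nbhd w ∩ X) ×ˢ (S.nbhd w ∩ X)) ≤
      S.rho * ∑ w ∈ X ∪ W, #(S.nbhd w ∩ X) := by
    rw [mul_sum]
    refine sum_le_sum fun w _ => ?_
    rw [card_product]
    refine Nat.mul_le_mul_right _ ((card_le_card inter_subset_left).trans ?_)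
    exact le_sup (f := fun v => #(S.nbhd v)) (mem_univ w)
  have hsub : ({p ∈ X ×ˢ X | p.1 ≠ p.2 ∧ ∃ w, p.1 ∈ S.nbhd w ∧ p.2 ∈ S.nbhd w} : Finset (V × V)) ⊆
      ({p ∈ X ×ˢ X | (G.contractFibers X φ).Adj p.1 p.2} : Finset (V × V)) ∪
      (X ∪ W).biUnion fun w => (S.nbhd w ∩ X) ×ˢ (S.nbhd w ∩ X) := by
    rintro ⟨a, b⟩ hab
    obtain ⟨hX, hne, w, haw, hbw⟩ := mem_filter.1 hab
    have hX' := mem_product.1 hX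
    by_cases hw : w ∈ X ∪ W
    · exact mem_union_right _ (mem_biUnion.2 ⟨w, hw, mem_product.2
        ⟨mem_inter.2 ⟨haw, hX'.1⟩, mem_inter.2 ⟨hbw, hX'.2⟩⟩⟩)
    · rw [mem_union, not_or] at hw
      exact mem_union_left _ (mem_filter.2 ⟨hX, h4 w hw.1 hw.2 a haw b hbw hX'.1 hX'.2 hne⟩)
  -- |W| ≤ 2d|X|, and d ≥ 1 absorbs |X|. The final 8 is 2 from the minor plus 2 · 3 from X ∪ W.
  have hY2 : #(X ∪ W) ≤ 3 * (d * #X) := by nlinarith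
  have h5 : S.rho * ∑ w ∈ X ∪ W, #(S.nbhd w ∩ X) ≤ S.rho * (2 * (d * (3 * (d * #X)))) :=
    Nat.mul_le_mul_left _ ((hsum.trans hY).trans (by gcongr))
  have h6 : d * #X ≤ d ^ 2 * S.rho * #X := by
    have : d * 1 ≤ d ^ 2 * S.rho := Nat.mul_le_mul (by nlinarith) hρ
    simpa using Nat.mul_le_mul_right #X this
  refine (card_le_card hsub).trans ((card_union_le _ _).trans ?_)
  have h7 := (card_biUnion_le (s := X ∪ W)
    (t := fun w => (S.nbhd w ∩ X) ×ˢ (S.nbhd w ∩ X))).trans (hsq.trans h5)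
  calc _ ≤ 2 * (d * #X) + S.rho * (2 * (d * (3 * (d * #X)))) := add_le_add hM h7
    _ ≤ 2 * (d ^ 2 * S.rho * #X) + S.rho * (2 * (d * (3 * (d * #X)))) := by omega
    _ = _ := by ring

open Classical SimpleGraph in
theorem chromaticNumber_le {V : Type*} [Fintype V] {G : SimpleGraph V} {t d : ℕ}
    (hG : G.CompleteMinorFree t) (hd : 3 * (t ^ 2 + t) ≤ d) (hd1 : 1 ≤ d)
    (S : NeighborhoodSystem G) (hρ : 1 ≤ S.rho) :
    S.chromaticNumber ≤ 8 * d ^ 2 * S.rho + 1 := by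
  refine Nat.sInf_le ?_
  obtain ⟨f, hf⟩ := exists_coloring_of_degenerate
    (fun u v => u ≠ v ∧ ∃ w, u ∈ S.nbhd w ∧ v ∈ S.nbhd w)
    (fun u v ⟨h, w, hu, hv⟩ => ⟨h.symm, w, hv, hu⟩) (8 * d ^ 2 * S.rho + 1) (by omega) (by
      intro X hX
      by_contra! hcon
      have h1 := card_pairs_le hG hd hd1 S hρ X
      rw [card_filter, sum_product] at h1
      have h2 := card_nsmul_le_sum X _ _ hcon
      simp only [card_filter] at h2
      have h3 : #X • (8 * d ^ 2 * S.rho + 1) ≤ 8 * d ^ 2 * S.rho * #X :=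
        h2.trans (le_trans (le_of_eq (by congr!)) h1)
      have h4 := card_pos.2 hX
      rw [smul_eq_mul] at h3
      nlinarith)
  exact ⟨f, fun w u hu v hv huv => hf u v huv ⟨huv, w, hu, hv⟩⟩

end NeighborhoodSystem

theorem mainTheorem7 :
    ∃ c : ℝ, ∀ (t : ℕ) (V : Type*) [Fintype V] (G : SimpleGraph V),
      G.CompleteMinorFree t →
      ∀ S : NeighborhoodSystem G, S.IsNonempty →
        (S.chromaticNumber : ℝ) ≤ c * (t : ℝ) ^ 4 * (Real.log t) ^ 2 * (S.rho : ℝ) := by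
  refine ⟨324, fun t V _ G hG S ⟨v, u, hu⟩ => ?_⟩
  have hρ : 1 ≤ S.rho :=
    (card_pos.2 ⟨u, hu⟩).trans_le (le_sup (f := fun v => #(S.nbhd v)) (mem_univ v))
  have hvu : G.Adj v u := S.adj_of_mem v u hu
  -- The edge vu is already a `K_t` minor for t ≤ 2; t ≥ 3 > e then gives log t ≥ 1.
  have ht : 3 ≤ t := by
    by_contra! ht
    refine hG ⟨fun i => {if i.1 = 0 then v else u}, fun i => ?_, fun i j hij => ?_,
      fun i j hij => ⟨_, rfl, _, rfl, ?_⟩⟩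
    · exact ⟨fun a b => by rw [Subsingleton.elim a b]⟩
    · have := hvu.ne
      have := hvu.ne'
      rw [Set.disjoint_singleton]
      split_ifs <;> omega
    · have hne : i ≠ j := hij
      split_ifs <;> first | omega | exact hvu | exact hvu.symm
  -- Since t ≤ t², d = 6t² is admissible, and 8d² = 288t⁴ leaves room below 324 for the extra
  -- colour.
  have h1 := S.chromaticNumber_le hG (d := 6 * t ^ 2) (by nlinarith) (by nlinarith) hρ
  have h2 : S.chromaticNumber ≤ 324 * t ^ 4 * S.rho := by
    have h3 : 1 ≤ t ^ 4 * S.rho := Nat.mul_pos (by positivity) hρ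
    calc _ ≤ _ := h1
      _ = 288 * (t ^ 4 * S.rho) + 1 := by ring
      _ ≤ 324 * (t ^ 4 * S.rho) := by omega
      _ = _ := by ring
  have hlog : 1 ≤ Real.log t := by
    rw [Real.le_log_iff_exp_le (by positivity)]
    exact (Real.exp_one_lt_three.le).trans (by exact_mod_cast ht)
  calc (S.chromaticNumber : ℝ) ≤ 324 * (t : ℝ) ^ 4 * S.rho := by exact_mod_cast h2
    _ = 324 * (t : ℝ) ^ 4 * 1 * S.rho := by ring
    _ ≤ _ := by
      gcongr
      exact one_le_pow₀ hlog
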